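/- Let $T$ be a partially ordered (or preordered) set in which every pair $s,t$ has an infimum, which has a largest element, and in which $]s,\infty[\,\subset\,]t,\infty[$ implies $s\ge t$, where $]t,\infty[=\{s\in T: s>t\}$. Let $\mathcal T^p$ be the ring of subsets of $T$ generated by the finite unions of the sets $]t,\infty[$, $t\in T$; it contains $\emptyset$. Order $\mathcal T^p$ by $\tau\le\upsilon$ if and only if $\upsilon\subset\tau$, so that $\emptyset$ is its largest element. Let $\mathcal C\subset\mathcal T^p$ be a family which contains $\emptyset$ and is linearly ordered (for instance $\mathcal C=\mathcal T^p$ when $\mathcal T^p$ itself is linearly ordered, or $\mathcal C=\{\bigcup_{n=1}^N\,]t_n,\infty[\,: N\ge 1,\ t_1,\dots,t_N\in T\}$ when $T$ is linearly ordered). Let $(\Omega,\mathcal F,P)$ be a probability space, $(\mathcal F_\tau)_{\tau\in\mathcal C}$ an increasing family of sub-$\sigma$-algebras of $\mathcal F$ with $\mathcal F_\emptyset=\mathcal F$, and $X=(X_\tau)_{\tau\in\mathcal C}$ a real submartingale: $X_\tau$ is integrable and $\mathcal F_\tau$-measurable, and $X_\tau\le E[X_\upsilon\mid\mathcal F_\tau]$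 a.s. whenever $\tau\le\upsilon$. $X$ is said to be of class $DM$ if the set of all sums $$S^d(X)=\sum_{\tau\cap\upsilon^c\in d}\bigl(E[X_\upsilon\mid\mathcal F_\tau]-X_\tau\bigr),$$ where $d$ ranges over the finite disjoint collections of sets $\tau\cap\upsilon^c$ with $\tau,\upsilon\in\mathcal C$, $\upsilon\subset\tau$, is relatively weakly compact in $L^1(\Omega,\mathcal F,P)$. $X$ is said to be of class $D$ if the set of all variables $$X_\sigma=\sum_{n=1}^N X_{\tau_n}\mathbf 1_{F_n}+X_\emptyset\,\mathbf 1_{\bigcap_n F_n^c},$$ where $N\ge 0$, $\tau_n\in\mathcal C$, $F_n\in\mathcal F_{\tau_n}$ and the $F_n$ are pairwise disjoint (the values of $X$ at simple stopping times), is relatively weakly compact in $L^1(\Omega,\mathcal F,P)$. Then $X$ is of class $DM$ if and only if it is of class $D$. -/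

import Mathlib

open MeasureTheory Set

noncomputable section

namespace SemilatticeProcess

/-- The sets `]t₁,∞[ ∪ … ∪ ]t_N,∞[` with `N ≥ 1`, where `]t,∞[ = {s | t < s}`. -/
def upperUnions (T : Type*) [Preorder T] : Set (Set T) :=
  {A | ∃ s : Finset T, s.Nonempty ∧ A = ⋃ t ∈ s, Ioi t}

/-- The ring of sets `𝒯ᵖ` generated by the finite unions of the intervals `]t,∞[`. -/
def predictableRing (T : Type*) [Preorder T] : Set (Set T) :=
  {A | ∀ R : Set (Set T), IsSetRing R → upperUnions T ⊆ R → A ∈ R}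

/-- The index set given by a family of sets `𝒞`, ordered by reverse inclusion:
`τ ≤ υ` means `υ ⊆ τ`. -/
abbrev Index {T : Type*} (𝒞 : Set (Set T)) : Type _ := (↥𝒞)ᵒᵈ

/-- The subset of `T` that an index is. -/
def Index.toSet {T : Type*} {𝒞 : Set (Set T)} (τ : Index 𝒞) : Set T :=
  ((OrderDual.ofDual τ : ↥𝒞) : Set T)

/-- The index `∅`, which is the largest one. -/
def Index.last {T : Type*} {𝒞 : Set (Set T)} (h : ∅ ∈ 𝒞) : Index 𝒞 :=
  OrderDual.toDual ⟨∅, h⟩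

variable {T Ω : Type*} {mΩ : MeasurableSpace Ω} {𝒞 : Set (Set T)}

/-- A finite disjoint collection of sets `τ ∩ υᶜ` with `τ, υ` in `𝒞` and `υ ⊆ τ`; such a set is
recorded by the pair `(τ, υ)`. -/
def IsDisjointCollection (d : Finset (Index 𝒞 × Index 𝒞)) : Prop :=
  (∀ p ∈ d, p.1 ≤ p.2) ∧
    (d : Set (Index 𝒞 × Index 𝒞)).PairwiseDisjoint fun p => p.1.toSet ∩ p.2.toSetᶜ

/-- `S^d(X) = ∑_{τ ∩ υᶜ ∈ d} (P(X_υ | F_τ) - X_τ)`. -/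
def conditionalSum (P : Measure Ω) (F : Filtration (Index 𝒞) mΩ) (X : Index 𝒞 → Ω → ℝ)
    (d : Finset (Index 𝒞 × Index 𝒞)) : Ω → ℝ :=
  fun ω => ∑ p ∈ d, ((P[X p.2 | F p.1]) ω - X p.1 ω)

/-- The set `𝒮(X)` of all `S^d(X)`, as a subset of `L¹`. -/
def conditionalSums (P : Measure Ω) (F : Filtration (Index 𝒞) mΩ) (X : Index 𝒞 → Ω → ℝ) :
    Set (Lp ℝ 1 P) :=
  {f | ∃ d : Finset (Index 𝒞 × Index 𝒞),
    IsDisjointCollection d ∧ f =ᵐ[P] conditionalSum P F X d}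

/-- A simple stopping time `σ = ∑ₙ τₙ 1_{Aₙ}`: finitely many pairwise disjoint events `Aₙ`, with
`Aₙ ∈ F_{τₙ}`; the value is the largest index `∅` outside all the `Aₙ`. -/
structure SimpleStoppingTime (F : Filtration (Index 𝒞) mΩ) where
  N : ℕ
  time : Fin N → Index 𝒞
  event : Fin N → Set Ω
  measurable_event : ∀ n, MeasurableSet[F (time n)] (event n)
  disjoint_event : Pairwise fun m n => Disjoint (event m) (event n)

/-- The value `X_σ = ∑ₙ X_{τₙ} 1_{Aₙ} + X_∅ 1_{⋂ₙ Aₙᶜ}` of `X` at `σ`. -/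
def valueAt {F : Filtration (Index 𝒞) mΩ} (h : ∅ ∈ 𝒞) (X : Index 𝒞 → Ω → ℝ)
    (σ : SimpleStoppingTime F) : Ω → ℝ :=
  fun ω => ∑ n, (σ.event n).indicator (X (σ.time n)) ω
    + (⋂ n, (σ.event n)ᶜ).indicator (X (Index.last h)) ω

/-- The set `D(X)` of all the values `X_σ`, as a subset of `L¹`. -/
def stoppedValues (P : Measure Ω) (F : Filtration (Index 𝒞) mΩ) (h : ∅ ∈ 𝒞)
    (X : Index 𝒞 → Ω → ℝ) : Set (Lp ℝ 1 P) :=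
  {f | ∃ σ : SimpleStoppingTime F, f =ᵐ[P] valueAt h X σ}

/-- The closure of `S` in the weak topology is weakly compact. -/
def IsRelativelyWeaklyCompact {E : Type*} [NormedAddCommGroup E] [NormedSpace ℝ E]
    (S : Set E) : Prop :=
  IsCompact (closure (toWeakSpace ℝ E '' S))

/-- Every `S^d(X)` is in `L¹` when `X` is locally integrable, so nothing is lost by reading
`𝒮(X)` as a subset of `L¹`. -/
def ClassDM (P : Measure Ω) (F : Filtration (Index 𝒞) mΩ) (X : Index 𝒞 → Ω → ℝ) : Prop :=
  IsRelativelyWeaklyCompact (conditionalSums P F X)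

/-- Every `X_σ` is in `L¹` when `X` is locally integrable. -/
def ClassD (P : Measure Ω) (F : Filtration (Index 𝒞) mΩ) (h : ∅ ∈ 𝒞)
    (X : Index 𝒞 → Ω → ℝ) : Prop :=
  IsRelativelyWeaklyCompact (stoppedValues P F h X)

end SemilatticeProcess

end

/-!
For a submartingale indexed by a chain, the classes DM and D are compared through uniform
integrability, which on a probability space is the same as relative weak compactness in `L¹`.
Both halves of this Dunford–Pettis theorem are proved below. A uniformly integrable set is
approximated in norm by balls of `L²`, and norm approximation by weakly compact sets suffices
(`isRelativelyWeaklyCompact_of_truncation`). Conversely, a relatively weakly compact set is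
uniformly absolutely continuous, by an inductive choice of sets in the manner of the
Vitali–Hahn–Saks theorem (`IsRelativelyWeaklyCompact.uniformlyAbsolutelyContinuous`).

The sums `S^d(X)` are the terminal values of the increasing processes of discrete Doob
decompositions. From DM to D: for a simple stopping time `σ`, let `d` be the chain of intervals
through its times and `∅`. With `A = S^d(X)`, the submartingale property gives
`E[X_∅ - A | F_σ] ≤ X_σ ≤ E[X_∅ | F_σ]` (`exists_chain_condIncrement`), so that on the events
`{X_σ > c}` and `{X_σ < -c}`, which belong to `F_σ`, the integral of `|X_σ|` is at most that of
`|X_∅| + A`.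

From D to DM: given a disjoint collection `d`, whose nonempty members are intervals that follow one
another, put `A = S^d(X)` and stop at the left end `σ` of the interval over which the partial sums
of `A` first exceed `c`; this is a stopping time because the partial sums are predictable. Then
`∫_{A > c} (A - c) ≤ ∫_{A > c} (X_∅ - X_σ)` (`exists_crossing_events`). The means of the sums `A`
are bounded, so `{A > c}` has uniformly small probability for large `c` and the right side is
uniformly small. Since `A ≤ 2 (A - c)` where `A > 2c`, the sums are uniformly integrable.
-/

open Filter Topology
open scoped ENNReal

namespace SemilatticeProcess

/-! ### Weak compactness in Banach spaces -/

section WeakCompactness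

variable {E : Type*} [NormedAddCommGroup E] [NormedSpace ℝ E]

lemma tendsto_toWeakSpace_iff {ι : Type*} {l : Filter ι} {u : ι → E} {x : E} :
    Tendsto (fun i => toWeakSpace ℝ E (u i)) l (𝓝 (toWeakSpace ℝ E x)) ↔
      ∀ φ : StrongDual ℝ E, Tendsto (fun i => φ (u i)) l (𝓝 (φ x)) := by
  refine WeakBilin.tendsto_iff_forall_eval_tendsto (B := (topDualPairing ℝ E).flip)
    fun a b hab => ?_
  by_contra hne
  obtain ⟨f, hf⟩ := SeparatingDual.exists_separating_of_ne (R := ℝ) hne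
  exact hf (DFunLike.congr_fun hab f)

lemma continuous_dual_toWeakSpace_symm (φ : StrongDual ℝ E) :
    Continuous fun x : WeakSpace ℝ E => φ ((toWeakSpace ℝ E).symm x) :=
  WeakBilin.eval_continuous (topDualPairing ℝ E).flip φ

lemma IsCompact.exists_weak_limit {K : Set E} (hK : IsCompact (toWeakSpace ℝ E '' K))
    {ι : Type*} (U : Ultrafilter ι) {u : ι → E} (hu : ∀ᶠ i in U, u i ∈ K) :
    ∃ k ∈ K, ∀ φ : StrongDual ℝ E, Tendsto (fun i => φ (u i)) U (𝓝 (φ k)) := by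
  obtain ⟨_, ⟨k, hk, rfl⟩, hle⟩ := isCompact_iff_ultrafilter_le_nhds.1 hK
    (U.map fun i => toWeakSpace ℝ E (u i)) (by
      rw [le_principal_iff]
      exact hu.mono fun i hi => Set.mem_image_of_mem _ hi)
  exact ⟨k, hk, tendsto_toWeakSpace_iff.1 hle⟩

lemma IsRelativelyWeaklyCompact.exists_weak_limit {S : Set E}
    (hS : IsRelativelyWeaklyCompact S) {ι : Type*} (U : Ultrafilter ι) {u : ι → E}
    (hu : ∀ i, u i ∈ S) :
    ∃ k, ∀ φ : StrongDual ℝ E, Tendsto (fun i => φ (u i)) U (𝓝 (φ k)) := by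
  have hS' : IsCompact (toWeakSpace ℝ E ''
      ((toWeakSpace ℝ E).symm '' closure (toWeakSpace ℝ E '' S))) := by
    simpa [Set.image_image, IsRelativelyWeaklyCompact] using hS
  obtain ⟨k, -, hk⟩ := IsCompact.exists_weak_limit hS' U (u := u) (.of_forall fun i =>
    ⟨toWeakSpace ℝ E (u i), subset_closure ⟨_, hu i, rfl⟩, by simp⟩)
  exact ⟨k, hk⟩

lemma IsRelativelyWeaklyCompact.exists_bound {S : Set E}
    (hS : IsRelativelyWeaklyCompact S) (φ : StrongDual ℝ E) : ∃ C, ∀ f ∈ S, |φ f| ≤ C := by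
  obtain ⟨C, hC⟩ := IsCompact.exists_bound_of_continuousOn hS
    (continuous_dual_toWeakSpace_symm φ).continuousOn
  exact ⟨C, fun f hf => by simpa using hC _ (subset_closure ⟨f, hf, rfl⟩)⟩

/-- Weak lower semicontinuity of the norm. -/
lemma norm_le_of_tendsto_dual {ι : Type*} {l : Filter ι} [l.NeBot] {u : ι → E} {x : E}
    {c : ℝ} (h : ∀ φ : StrongDual ℝ E, Tendsto (fun i => φ (u i)) l (𝓝 (φ x)))
    (hc : ∀ᶠ i in l, ‖u i‖ ≤ c) : ‖x‖ ≤ c := by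
  have hc0 : 0 ≤ c := by
    obtain ⟨i, hi⟩ := hc.exists
    exact (norm_nonneg _).trans hi
  refine NormedSpace.norm_le_dual_bound ℝ x hc0 fun φ => ?_
  refine le_of_tendsto (h φ).norm (hc.mono fun i hi => ?_)
  rw [mul_comm]
  exact φ.le_of_opNorm_le_of_le le_rfl hi

/-- The points that every `K n` approximates up to `1 / (n + 1)` form a weakly compact set: along
an ultrafilter, the approximants in `K n` converge weakly to some `k n`, and as the norm is weakly
lower semicontinuous, the `k n` form a Cauchy sequence, whose limit is the weak limit sought. -/
lemma isCompact_toWeakSpace_image_of_approx [CompleteSpace E] (K : ℕ → Set E)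
    (hK : ∀ n, IsCompact (toWeakSpace ℝ E '' K n)) :
    IsCompact (toWeakSpace ℝ E '' {f | ∀ n : ℕ, ∃ k ∈ K n, ‖f - k‖ ≤ 1 / ((n : ℝ) + 1)}) := by
  set S' : Set E := {f | ∀ n : ℕ, ∃ k ∈ K n, ‖f - k‖ ≤ 1 / ((n : ℝ) + 1)} with hS'
  rw [isCompact_iff_ultrafilter_le_nhds]
  intro U hU
  set V : Ultrafilter E := U.map (toWeakSpace ℝ E).symm with hV
  have hVS : ∀ᶠ f in V, f ∈ S' := by
    rw [le_principal_iff] at hU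
    change ∀ᶠ x in (U : Filter (WeakSpace ℝ E)), (toWeakSpace ℝ E).symm x ∈ S'
    filter_upwards [hU]
    rintro _ ⟨f, hf, rfl⟩
    simpa using hf
  have hp : ∀ n : ℕ, ∃ p : E → E, ∀ f ∈ S', p f ∈ K n ∧ ‖f - p f‖ ≤ 1 / ((n : ℝ) + 1) := by
    intro n
    choose! p hp using fun (f : E) (hf : f ∈ S') => hf n
    exact ⟨p, hp⟩
  choose p hp using hp
  have hk : ∀ n, ∃ k ∈ K n, ∀ φ : StrongDual ℝ E,
      Tendsto (fun f => φ (p n f)) V (𝓝 (φ k)) := fun n =>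
    IsCompact.exists_weak_limit (hK n) V (hVS.mono fun f hf => (hp n f hf).1)
  choose k hkK hk using hk
  have hdist : ∀ m n : ℕ, ‖k m - k n‖ ≤ 1 / ((m : ℝ) + 1) + 1 / ((n : ℝ) + 1) := by
    intro m n
    refine norm_le_of_tendsto_dual (l := (V : Filter E)) (u := fun f => p m f - p n f)
      (fun φ => by simpa using (hk m φ).sub (hk n φ)) (hVS.mono fun f hf => ?_)
    calc ‖p m f - p n f‖ = ‖(f - p n f) - (f - p m f)‖ := by congr 1; abel
      _ ≤ ‖f - p n f‖ + ‖f - p m f‖ := norm_sub_le _ _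
      _ ≤ _ := by linarith [(hp m f hf).2, (hp n f hf).2]
  have hlim : Tendsto (fun n : ℕ => 1 / ((n : ℝ) + 1)) atTop (𝓝 0) :=
    tendsto_one_div_add_atTop_nhds_zero_nat
  have hanti : ∀ {m n : ℕ}, m ≤ n → 1 / ((n : ℝ) + 1) ≤ 1 / ((m : ℝ) + 1) := fun h =>
    Nat.one_div_le_one_div h
  obtain ⟨x, hx⟩ : ∃ x, Tendsto k atTop (𝓝 x) := by
    refine cauchySeq_tendsto_of_complete (cauchySeq_of_le_tendsto_0
      (fun n : ℕ => 2 * (1 / ((n : ℝ) + 1))) (fun n m N hn hm => ?_) ?_)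
    · rw [dist_eq_norm]
      linarith [hdist n m, hanti hn, hanti hm]
    · simpa using hlim.const_mul 2
  have hkx : ∀ m : ℕ, ‖k m - x‖ ≤ 1 / ((m : ℝ) + 1) := fun m => by
    refine le_of_tendsto_of_tendsto (tendsto_const_nhds.sub hx).norm
      (by simpa using hlim.const_add (1 / ((m : ℝ) + 1))) (.of_forall fun n => hdist m n)
  refine ⟨toWeakSpace ℝ E x, ⟨x, fun n => ⟨k n, hkK n, by rw [norm_sub_rev]; exact hkx n⟩, rfl⟩, ?_⟩
  have hVx : Tendsto (fun f => toWeakSpace ℝ E f) V (𝓝 (toWeakSpace ℝ E x)) := by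
    refine tendsto_toWeakSpace_iff.2 fun φ => Metric.tendsto_nhds.2 fun ε hε => ?_
    obtain ⟨n, hn⟩ : ∃ n : ℕ, ‖φ‖ * (1 / ((n : ℝ) + 1)) < ε / 3 := by
      have := hlim.const_mul ‖φ‖
      rw [mul_zero] at this
      exact (this.eventually (gt_mem_nhds (by positivity))).exists
    filter_upwards [hVS, Metric.tendsto_nhds.1 (hk n φ) (ε / 3) (by positivity)] with f hf hfn
    have h1 : ‖φ (f - p n f)‖ ≤ ‖φ‖ * (1 / ((n : ℝ) + 1)) :=
      φ.le_of_opNorm_le_of_le le_rfl (hp n f hf).2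
    have h2 : ‖φ (k n - x)‖ ≤ ‖φ‖ * (1 / ((n : ℝ) + 1)) :=
      φ.le_of_opNorm_le_of_le le_rfl (hkx n)
    rw [dist_eq_norm] at hfn ⊢
    calc ‖φ f - φ x‖ = ‖φ (f - p n f) + (φ (p n f) - φ (k n)) + φ (k n - x)‖ := by
          congr 1; simp
      _ ≤ ‖φ (f - p n f)‖ + ‖φ (p n f) - φ (k n)‖ + ‖φ (k n - x)‖ := norm_add₃_le
      _ < ε := by linarith
  simpa [hV, Tendsto, Filter.map_map, Function.comp_def] using hVx

/-- Grothendieck's criterion: a set is relatively weakly compact if weakly compact sets approximate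
it uniformly in norm. -/
lemma isRelativelyWeaklyCompact_of_approx [CompleteSpace E] {S : Set E}
    (h : ∀ ε > 0, ∃ K : Set E, IsCompact (toWeakSpace ℝ E '' K) ∧
      ∀ f ∈ S, ∃ k ∈ K, ‖f - k‖ ≤ ε) : IsRelativelyWeaklyCompact S := by
  choose K hK hSK using fun n : ℕ => h (1 / ((n : ℝ) + 1)) (by positivity)
  exact (isCompact_toWeakSpace_image_of_approx K hK).closure_of_subset
    (Set.image_mono fun f hf n => hSK n f hf)

/-- Balls of a Hilbert space have weakly compact images under continuous linear maps, by the
Banach–Alaoglu theorem in the dual. -/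
lemma isCompact_toWeakSpace_image_closedBall {H : Type*} [NormedAddCommGroup H]
    [InnerProductSpace ℝ H] [CompleteSpace H] (L : H →L[ℝ] E) (R : ℝ) :
    IsCompact (toWeakSpace ℝ E '' (L '' Metric.closedBall 0 R)) := by
  set e := InnerProductSpace.toDual ℝ H
  have hcont : Continuous fun ψ : WeakDual ℝ H =>
      toWeakSpace ℝ E (L (e.symm (WeakDual.toStrongDual ψ))) := by
    refine WeakBilin.continuous_of_continuous_eval (topDualPairing ℝ E).flip fun φ => ?_
    -- By the Riesz representation of `φ ∘ L`, this is the evaluation of `ψ` at a fixed vector.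
    have : (fun ψ : WeakDual ℝ H => φ (L (e.symm (WeakDual.toStrongDual ψ)))) =
        fun ψ => ψ (e.symm (φ.comp L)) := by
      funext ψ
      have h1 : (φ.comp L) (e.symm (WeakDual.toStrongDual ψ)) =
          inner ℝ (e.symm (φ.comp L)) (e.symm (WeakDual.toStrongDual ψ)) := by
        rw [InnerProductSpace.toDual_symm_apply]
      have h2 : ψ (e.symm (φ.comp L)) =
          inner ℝ (e.symm (WeakDual.toStrongDual ψ)) (e.symm (φ.comp L)) := by
        rw [InnerProductSpace.toDual_symm_apply]; rfl
      rw [h2, real_inner_comm, ← h1]; rfl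
    change Continuous fun ψ : WeakDual ℝ H => φ (L (e.symm (WeakDual.toStrongDual ψ)))
    rw [this]
    exact WeakDual.eval_continuous _
  convert (WeakDual.isCompact_closedBall (𝕜 := ℝ) (E := H) 0 R).image hcont using 1
  ext y
  constructor
  · rintro ⟨_, ⟨x, hx, rfl⟩, rfl⟩
    refine ⟨StrongDual.toWeakDual (e x), ?_, by simp⟩
    simpa [e] using hx
  · rintro ⟨ψ, hψ, rfl⟩
    exact ⟨_, ⟨e.symm (WeakDual.toStrongDual ψ), by simpa [e] using hψ, rfl⟩, rfl⟩

end WeakCompactness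

/-! ### The Dunford–Pettis theorem -/

section DunfordPettis

variable {Ω : Type*} {mΩ : MeasurableSpace Ω} {P : Measure Ω}

/-- Integration over a fixed set, as a continuous linear functional on `L¹`. -/
noncomputable def setIntegralDual (P : Measure Ω) (A : Set Ω) : StrongDual ℝ (Lp ℝ 1 P) where
  toFun f := ∫ ω in A, f ω ∂P
  map_add' f g := by
    rw [← integral_add (L1.integrable_coeFn f).integrableOn (L1.integrable_coeFn g).integrableOn]
    exact integral_congr_ae (ae_restrict_of_ae (Lp.coeFn_add f g))
  map_smul' c f := by
    rw [RingHom.id_apply, smul_eq_mul, ← integral_const_mul]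
    exact integral_congr_ae (ae_restrict_of_ae (Lp.coeFn_smul c f))
  cont := continuous_setIntegral A

@[simp]
lemma setIntegralDual_apply (A : Set Ω) (f : Lp ℝ 1 P) :
    setIntegralDual P A f = ∫ ω in A, f ω ∂P := rfl

/-- The inclusion of `L²` in `L¹` over a probability space. -/
noncomputable def inclusionL2L1 (P : Measure Ω) [IsProbabilityMeasure P] : Lp ℝ 2 P →L[ℝ] Lp ℝ 1 P :=
  LinearMap.mkContinuous
    { toFun := fun f => ((Lp.memLp f).mono_exponent one_le_two).toLp f
      map_add' := fun f g => by
        rw [← MemLp.toLp_add]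
        exact MemLp.toLp_congr _ _ (Lp.coeFn_add f g)
      map_smul' := fun c f => by
        rw [RingHom.id_apply, ← MemLp.toLp_const_smul]
        exact MemLp.toLp_congr _ _ (Lp.coeFn_smul c f) } 1 (fun f => by
    rw [one_mul]
    change ‖((Lp.memLp f).mono_exponent one_le_two).toLp f‖ ≤ _
    rw [Lp.norm_toLp, Lp.norm_def]
    exact ENNReal.toReal_mono (Lp.memLp f).2.ne
      (eLpNorm_le_eLpNorm_of_exponent_le one_le_two (Lp.aestronglyMeasurable f)))

lemma coeFn_inclusionL2L1 [IsProbabilityMeasure P] (f : Lp ℝ 2 P) :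
    inclusionL2L1 P f =ᵐ[P] f :=
  MemLp.coeFn_toLp ((Lp.memLp f).mono_exponent one_le_two)

/-- The half of the Dunford–Pettis theorem that produces compactness: truncation approximates a
uniformly integrable set in `L¹` norm by balls of `L²`, which are weakly compact. -/
theorem isRelativelyWeaklyCompact_of_truncation [IsProbabilityMeasure P] {S : Set (Lp ℝ 1 P)}
    (h : ∀ ε > 0, ∃ M : ℝ, ∀ f ∈ S, ∫ ω in {ω | M < |f ω|}, |f ω| ∂P ≤ ε) :
    IsRelativelyWeaklyCompact S := by
  refine isRelativelyWeaklyCompact_of_approx fun ε hε => ?_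
  obtain ⟨M, hM⟩ := h ε hε
  refine ⟨_, isCompact_toWeakSpace_image_closedBall (inclusionL2L1 P) (max M 0), fun f hf => ?_⟩
  set B : Set Ω := {ω | M < |f ω|} with hB
  have hfm : StronglyMeasurable f := Lp.stronglyMeasurable f
  have hBm : MeasurableSet B := measurableSet_lt measurable_const hfm.measurable.abs
  have hbd : ∀ ω, ‖Bᶜ.indicator f ω‖ ≤ max M 0 := fun ω => by
    by_cases hω : ω ∈ Bᶜ
    · rw [Set.indicator_of_mem hω, Real.norm_eq_abs]
      exact (not_lt.1 (show ¬ M < |f ω| from hω)).trans (le_max_left _ _)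
    · rw [Set.indicator_of_notMem hω, norm_zero]
      exact le_max_right _ _
  have hmem : MemLp (Bᶜ.indicator f) 2 P :=
    MemLp.of_bound (hfm.indicator hBm.compl).aestronglyMeasurable _ (.of_forall hbd)
  refine ⟨inclusionL2L1 P (hmem.toLp _), ⟨_, ?_, rfl⟩, ?_⟩
  · rw [mem_closedBall_zero_iff]
    refine (Lp.norm_le_of_ae_bound (le_max_right M 0) (C := max M 0) ?_).trans ?_
    · filter_upwards [hmem.coeFn_toLp] with ω hω
      rw [hω]; exact hbd ω
    · simp [measureUnivNNReal]
  · rw [L1.norm_eq_integral_norm]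
    refine le_of_eq_of_le ?_ (hM f hf)
    rw [← integral_indicator hBm]
    refine integral_congr_ae ?_
    filter_upwards [Lp.coeFn_sub f (inclusionL2L1 P (hmem.toLp _)),
      coeFn_inclusionL2L1 (hmem.toLp _), hmem.coeFn_toLp] with ω h1 h2 h3
    rw [h1, Pi.sub_apply, h2, h3]
    by_cases hω : ω ∈ B
    · simp [hω]
    · simp [hω]

/-- Uniform absolute continuity: the integrals `∫_A |f|` are small for `P A` small, uniformly over
the family. -/
def UniformlyAbsolutelyContinuous (P : Measure Ω) (S : Set (Lp ℝ 1 P)) : Prop :=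
  ∀ ε > 0, ∃ δ > 0, ∀ f ∈ S, ∀ A, MeasurableSet A → P.real A ≤ δ → ∫ ω in A, |f ω| ∂P ≤ ε

lemma exists_subset_le_abs_setIntegral {f : Ω → ℝ} (hf : Integrable f P)
    (hfm : StronglyMeasurable f) {A : Set Ω} (hA : MeasurableSet A) :
    ∃ B ⊆ A, MeasurableSet B ∧ (∫ ω in A, |f ω| ∂P) / 2 ≤ |∫ ω in B, f ω ∂P| := by
  have hm : MeasurableSet {ω | 0 ≤ f ω} := measurableSet_le measurable_const hfm.measurable
  have hsplit := integral_inter_add_sdiff (s := A) hm hf.abs.integrableOn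
  have h1 : ∫ ω in A ∩ {ω | 0 ≤ f ω}, |f ω| ∂P = ∫ ω in A ∩ {ω | 0 ≤ f ω}, f ω ∂P :=
    setIntegral_congr_fun (hA.inter hm) fun ω hω => abs_of_nonneg hω.2
  have h2 : ∫ ω in A \ {ω | 0 ≤ f ω}, |f ω| ∂P = -∫ ω in A \ {ω | 0 ≤ f ω}, f ω ∂P := by
    rw [← integral_neg]
    exact setIntegral_congr_fun (hA.diff hm) fun ω hω => abs_of_neg (not_le.1 hω.2)
  by_cases h : (∫ ω in A, |f ω| ∂P) / 2 ≤ ∫ ω in A ∩ {ω | 0 ≤ f ω}, |f ω| ∂P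
  · exact ⟨_, Set.inter_subset_left, hA.inter hm, h.trans (by rw [h1]; exact le_abs_self _)⟩
  · refine ⟨_, Set.sdiff_subset, hA.diff hm, le_trans ?_ (neg_le_abs _)⟩
    rw [← h2]
    linarith

lemma abs_setIntegral_sub_le {g : Ω → ℝ} (hg : Integrable g P) {A B D : Set Ω}
    (hA : MeasurableSet A) (hB : MeasurableSet B)
    (hAB : A \ B ⊆ D) (hBA : B \ A ⊆ D) :
    |(∫ ω in A, g ω ∂P) - ∫ ω in B, g ω ∂P| ≤ ∫ ω in D, |g ω| ∂P := by
  have e1 := integral_inter_add_sdiff (s := A) hB hg.integrableOn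
  have e2 := integral_inter_add_sdiff (s := B) hA hg.integrableOn
  rw [Set.inter_comm] at e2
  have : (∫ ω in A, g ω ∂P) - ∫ ω in B, g ω ∂P =
      (∫ ω in A \ B, g ω ∂P) - ∫ ω in B \ A, g ω ∂P := by linarith
  rw [this]
  calc _ ≤ |∫ ω in A \ B, g ω ∂P| + |∫ ω in B \ A, g ω ∂P| := abs_sub _ _
    _ ≤ (∫ ω in A \ B, |g ω| ∂P) + ∫ ω in B \ A, |g ω| ∂P :=
        add_le_add abs_integral_le_integral_abs abs_integral_le_integral_abs
    _ = ∫ ω in (A \ B) ∪ (B \ A), |g ω| ∂P :=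
        (setIntegral_union (Set.disjoint_left.2 fun ω h h' => h'.2 h.1) (hB.diff hA)
          hg.abs.integrableOn hg.abs.integrableOn).symm
    _ ≤ _ := setIntegral_mono_set hg.abs.integrableOn (.of_forall fun _ => abs_nonneg _)
        (Set.union_subset hAB hBA).eventuallyLE

/-- The sets `⋃_{m ≥ n} A m` have measure tending to zero when `∑ P (A n)` converges
geometrically. -/
lemma tendsto_measure_iUnion_ge {A : ℕ → Set Ω} (hA : ∀ n, P (A n) ≤ 2⁻¹ ^ n) :
    Tendsto (fun n => P (⋃ m ≥ n, A m)) atTop (𝓝 0) := by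
  have hs : ∑' n, P (A n) ≠ ∞ := by
    refine ne_top_of_le_ne_top ?_ (ENNReal.tsum_le_tsum hA)
    rw [ENNReal.tsum_geometric]
    simp
  refine tendsto_of_tendsto_of_tendsto_of_le_of_le tendsto_const_nhds
    (ENNReal.tendsto_sum_nat_add (fun n => P (A n)) hs) (fun _ => zero_le) fun n => ?_
  have : (⋃ m ≥ n, A m) ⊆ ⋃ m, A (m + n) := by
    intro ω hω
    simp only [Set.mem_iUnion] at hω ⊢
    obtain ⟨m, hm, h⟩ := hω
    exact ⟨m - n, by rwa [Nat.sub_add_cancel hm]⟩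
  exact (measure_mono this).trans (measure_iUnion_le _)

/-- The integrals over `E ∪ B` and `E \ B` differ by the integral over `B`, so one of them has at
least half its size. -/
lemma exists_half_le_abs_setIntegral {g : Ω → ℝ} (hg : Integrable g P) (E : Set Ω) {B : Set Ω}
    (hB : MeasurableSet B) {η : ℝ} (h : η ≤ |∫ ω in B, g ω ∂P|) :
    ∃ E', (E' = E ∪ B ∨ E' = E \ B) ∧ η / 2 ≤ |∫ ω in E', g ω ∂P| := by
  have key : ∫ ω in E ∪ B, g ω ∂P = (∫ ω in E \ B, g ω ∂P) + ∫ ω in B, g ω ∂P := by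
    rw [← setIntegral_union Set.disjoint_sdiff_left hB hg.integrableOn hg.integrableOn,
      Set.sdiff_union_self]
  by_cases h1 : η / 2 ≤ |∫ ω in E ∪ B, g ω ∂P|
  · exact ⟨_, Or.inl rfl, h1⟩
  · refine ⟨_, Or.inr rfl, ?_⟩
    have : |∫ ω in B, g ω ∂P| ≤ |∫ ω in E ∪ B, g ω ∂P| + |∫ ω in E \ B, g ω ∂P| := by
      rw [show ∫ ω in B, g ω ∂P = (∫ ω in E ∪ B, g ω ∂P) - ∫ ω in E \ B, g ω ∂P by linarith]
      exact abs_sub _ _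
    linarith

/-- The half of the Dunford–Pettis theorem that uses compactness. If it failed, there would be
`u n` in `S` and sets `B n` of rapidly decreasing measure with `∫_{B n} u n` bounded away from
zero. Let `f` be a weak limit of `u` along an ultrafilter. Passing to a subsequence, adding or
removing `B n` one at a time produces sets `E k`, converging in measure to a set `E∞`, such that
`∫_{E∞} (u (n k) - f)` stays away from zero while `∫_{E j} (u (n k) - f)` tends to zero for each
`j`. The integrals of a weak limit of the subsequence and of `f` then agree on every `E j`, hence
on `E∞`, which is absurd. -/
theorem IsRelativelyWeaklyCompact.uniformlyAbsolutelyContinuous [IsProbabilityMeasure P]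
    {S : Set (Lp ℝ 1 P)} (hS : IsRelativelyWeaklyCompact S) :
    UniformlyAbsolutelyContinuous P S := by
  by_contra hcon
  unfold UniformlyAbsolutelyContinuous at hcon
  push Not at hcon
  obtain ⟨ε, hε, hcon⟩ := hcon
  choose u hu A hAm hPA huA using fun n : ℕ => hcon ((2⁻¹ : ℝ) ^ n) (by positivity)
  choose B hBA hBm hB using fun n => exists_subset_le_abs_setIntegral
    (L1.integrable_coeFn (u n)) (Lp.stronglyMeasurable (u n)) (hAm n)
  have hPB : ∀ n, P (B n) ≤ 2⁻¹ ^ n := fun n => by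
    refine (measure_mono (hBA n)).trans ?_
    rw [← ENNReal.ofReal_toReal (measure_ne_top P (A n))]
    refine (ENNReal.ofReal_le_ofReal (hPA n)).trans_eq ?_
    rw [ENNReal.ofReal_pow (by positivity), ENNReal.ofReal_inv_of_pos two_pos]
    simp
  set tail : ℕ → Set Ω := fun n => ⋃ m ≥ n, B m with htail
  have htail_anti : Antitone tail := fun m n hmn => by
    simp only [htail]
    exact Set.iUnion_mono fun i => Set.iUnion_mono' fun hi => ⟨hmn.trans hi, le_rfl⟩
  have hB_tail : ∀ {m n}, m ≤ n → B n ⊆ tail m := fun {m n} h =>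
    Set.subset_iUnion₂ (s := fun i (_ : i ≥ m) => B i) n h
  have htail0 : ∀ h : Ω → ℝ, Integrable h P →
      Tendsto (fun n => ∫ ω in tail n, |h ω| ∂P) atTop (𝓝 0) := fun h hh =>
    hh.abs.tendsto_setIntegral_nhds_zero (tendsto_measure_iUnion_ge hPB)
  set U : Ultrafilter ℕ := hyperfilter ℕ with hU
  have hUtop : (U : Filter ℕ) ≤ atTop := Nat.hyperfilter_le_atTop
  obtain ⟨f, hf⟩ := hS.exists_weak_limit U hu
  set g : ℕ → Ω → ℝ := fun n ω => u n ω - f ω with hg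
  have hgi : ∀ n, Integrable (g n) P := fun n =>
    (L1.integrable_coeFn (u n)).sub (L1.integrable_coeFn f)
  have hgint : ∀ n D, ∫ ω in D, g n ω ∂P = (∫ ω in D, u n ω ∂P) - ∫ ω in D, f ω ∂P := fun n D =>
    integral_sub (L1.integrable_coeFn (u n)).integrableOn (L1.integrable_coeFn f).integrableOn
  have hglim : ∀ D, Tendsto (fun n => ∫ ω in D, g n ω ∂P) U (𝓝 0) := fun D => by
    simpa [hgint] using (hf (setIntegralDual P D)).sub_const (∫ ω in D, f ω ∂P)
  obtain ⟨n₀, hn₀⟩ : ∃ n₀, ∀ n ≥ n₀, ε / 4 ≤ |∫ ω in B n, g n ω ∂P| := by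
    obtain ⟨n₀, hn₀⟩ := ((htail0 f (L1.integrable_coeFn f)).eventually
      (ge_mem_nhds (show (0 : ℝ) < ε / 4 by positivity))).exists
    refine ⟨n₀, fun n hn => ?_⟩
    have h1 : |∫ ω in B n, f ω ∂P| ≤ ε / 4 := abs_integral_le_integral_abs.trans
      ((setIntegral_mono_set (L1.integrable_coeFn f).abs.integrableOn
        (.of_forall fun _ => abs_nonneg _) (hB_tail hn).eventuallyLE).trans hn₀)
    have h2 := abs_sub_abs_le_abs_sub (∫ ω in B n, u n ω ∂P) (∫ ω in B n, f ω ∂P)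
    rw [hgint]
    linarith [hB n, huA n]
  set η : ℝ := ε / 4 with hη
  have hη0 : 0 < η := by positivity
  choose N hN using fun n => ((htail0 (g n) (hgi n)).eventually
    (ge_mem_nhds (show (0 : ℝ) < η / 4 by positivity))).exists
  -- A state is the current index, the current set, and the list of the preceding sets.
  have hstep : ∀ x : ℕ × Set Ω × List (Set Ω), ∃ y : ℕ × Set Ω × List (Set Ω),
      x.1 < y.1 ∧ N x.1 ≤ y.1 ∧ n₀ ≤ y.1 ∧
      (∀ D ∈ x.2.1 :: x.2.2, |∫ ω in D, g y.1 ω ∂P| ≤ 1 / ((x.1 : ℝ) + 1)) ∧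
      (y.2.1 = x.2.1 ∪ B y.1 ∨ y.2.1 = x.2.1 \ B y.1) ∧
      η / 2 ≤ |∫ ω in y.2.1, g y.1 ω ∂P| ∧ y.2.2 = x.2.1 :: x.2.2 := by
    rintro ⟨n, E, l⟩
    have h1 : ∀ᶠ m in (U : Filter ℕ), ∀ D ∈ {D | D ∈ E :: l},
        |∫ ω in D, g m ω ∂P| ≤ 1 / ((n : ℝ) + 1) :=
      (eventually_all_finite (List.finite_toSet (E :: l))).2 fun D _ => by
        have := (hglim D).abs
        rw [abs_zero] at this
        exact this.eventually (ge_mem_nhds (by positivity))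
    obtain ⟨m, hm, hm1, hm2, hm3⟩ := (h1.and
      (((eventually_gt_atTop n).and ((eventually_ge_atTop (N n)).and
        (eventually_ge_atTop n₀))).filter_mono hUtop)).exists
    obtain ⟨E', hE', hE'2⟩ := exists_half_le_abs_setIntegral (hgi m) E (hBm m) (hn₀ m hm3)
    exact ⟨(m, E', E :: l), hm1, hm2, hm3, hm, hE', hE'2, rfl⟩
  choose step hstep using hstep
  set s : ℕ → ℕ × Set Ω × List (Set Ω) := fun k => step^[k] (0, ∅, []) with hs
  have hss : ∀ k, s (k + 1) = step (s k) := fun k => Function.iterate_succ_apply' _ _ _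
  set n : ℕ → ℕ := fun k => (s k).1 with hn
  set E : ℕ → Set Ω := fun k => (s k).2.1 with hE
  have hn_lt : ∀ k, n k < n (k + 1) := fun k => by
    simp only [hn, hss]; exact (hstep (s k)).1
  have hn_mono : StrictMono n := strictMono_nat_of_lt_succ hn_lt
  have hnN : ∀ k, N (n k) ≤ n (k + 1) := fun k => by
    simp only [hn, hss]; exact (hstep (s k)).2.1
  have hEsucc : ∀ k, E (k + 1) = E k ∪ B (n (k + 1)) ∨ E (k + 1) = E k \ B (n (k + 1)) :=
    fun k => by simp only [hE, hn, hss]; exact (hstep (s k)).2.2.2.2.1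
  have hEbig : ∀ k, η / 2 ≤ |∫ ω in E (k + 1), g (n (k + 1)) ω ∂P| := fun k => by
    simp only [hE, hn, hss]; exact (hstep (s k)).2.2.2.2.2.1
  have hmem : ∀ i, ∀ k ≤ i, E k ∈ (s i).2.1 :: (s i).2.2 := by
    intro i
    induction i with
    | zero => intro k hk; rw [Nat.le_zero.1 hk]; exact List.mem_cons_self
    | succ i ih =>
      intro k hk
      rcases Nat.le_succ_iff.1 hk with hk | rfl
      · refine List.mem_cons_of_mem _ ?_
        rw [hss i, (hstep (s i)).2.2.2.2.2.2]
        exact ih k hk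
      · exact List.mem_cons_self
  have hEsmall : ∀ i, ∀ k ≤ i, |∫ ω in E k, g (n (i + 1)) ω ∂P| ≤ 1 / ((i : ℝ) + 1) := by
    intro i k hk
    have h1 := (hstep (s i)).2.2.2.1 (E k) (hmem i k hk)
    rw [← hss] at h1
    exact h1.trans (Nat.one_div_le_one_div (hn_mono.id_le i))
  have hEm : ∀ k, MeasurableSet (E k) := by
    intro k
    induction k with
    | zero => exact MeasurableSet.empty
    | succ k ih =>
      rcases hEsucc k with h | h <;> rw [h]
      · exact ih.union (hBm _)
      · exact ih.diff (hBm _)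
  have hEE : ∀ k j, k ≤ j → ∀ ω ∉ tail (n (k + 1)), (ω ∈ E j ↔ ω ∈ E k) := by
    intro k j hkj ω hω
    induction j, hkj using Nat.le_induction with
    | base => rfl
    | succ j hkj ih =>
      have hωB : ω ∉ B (n (j + 1)) := fun h =>
        hω (hB_tail (hn_mono.monotone (Nat.succ_le_succ hkj)) h)
      rcases hEsucc j with h | h <;> rw [h, ← ih] <;> simp [hωB]
  set Einf : Set Ω := ⋃ i, ⋂ j ≥ i, E j with hEinf
  have hEinfm : MeasurableSet Einf :=
    .iUnion fun i => .iInter fun j => .iInter fun _ => hEm j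
  have hEinfE : ∀ k, ∀ ω ∉ tail (n (k + 1)), (ω ∈ Einf ↔ ω ∈ E k) := by
    intro k ω hω
    simp only [hEinf, Set.mem_iUnion, Set.mem_iInter]
    constructor
    · rintro ⟨i, hi⟩
      exact (hEE k (max i k) (le_max_right _ _) ω hω).1 (hi _ (le_max_left _ _))
    · exact fun h => ⟨k, fun j hj => (hEE k j hj ω hω).2 h⟩
  have happrox : ∀ h : Ω → ℝ, Integrable h P → ∀ k,
      |(∫ ω in E k, h ω ∂P) - ∫ ω in Einf, h ω ∂P| ≤ ∫ ω in tail (n (k + 1)), |h ω| ∂P :=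
    fun h hh k => abs_setIntegral_sub_le hh (hEm k) hEinfm
      (fun ω hω => by_contra fun hc => hω.2 ((hEinfE k ω hc).2 hω.1))
      (fun ω hω => by_contra fun hc => hω.2 ((hEinfE k ω hc).1 hω.1))
  have hbig : ∀ k, η / 4 ≤ |∫ ω in Einf, g (n (k + 1)) ω ∂P| := by
    intro k
    have h1 := happrox _ (hgi (n (k + 1))) (k + 1)
    have h2 : ∫ ω in tail (n (k + 1 + 1)), |g (n (k + 1)) ω| ∂P ≤ η / 4 :=
      (setIntegral_mono_set (hgi _).abs.integrableOn (.of_forall fun _ => abs_nonneg _)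
        (htail_anti (hnN (k + 1))).eventuallyLE).trans (hN _)
    have h3 := abs_sub_abs_le_abs_sub (∫ ω in E (k + 1), g (n (k + 1)) ω ∂P)
      (∫ ω in Einf, g (n (k + 1)) ω ∂P)
    linarith [hEbig k]
  obtain ⟨f', hf'⟩ := hS.exists_weak_limit U (u := fun i => u (n (i + 1))) fun i => hu _
  have hf'i : Integrable (fun ω => f' ω - f ω) P :=
    (L1.integrable_coeFn f').sub (L1.integrable_coeFn f)
  have hf'lim : ∀ D, Tendsto (fun i => ∫ ω in D, g (n (i + 1)) ω ∂P) U
      (𝓝 (∫ ω in D, (f' ω - f ω) ∂P)) := fun D => by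
    rw [integral_sub (L1.integrable_coeFn f').integrableOn (L1.integrable_coeFn f).integrableOn]
    simpa only [hgint, setIntegralDual_apply] using (hf' (setIntegralDual P D)).sub_const (∫ ω in D, f ω ∂P)
  have hzero : ∀ k, ∫ ω in E k, (f' ω - f ω) ∂P = 0 := fun k => by
    refine tendsto_nhds_unique (hf'lim (E k)) (Tendsto.mono_left ?_ hUtop)
    refine squeeze_zero_norm' ?_ tendsto_one_div_add_atTop_nhds_zero_nat
    filter_upwards [eventually_ge_atTop k] with i hi using hEsmall i k hi
  have hzero' : ∫ ω in Einf, (f' ω - f ω) ∂P = 0 := by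
    have h1 : Tendsto (fun k => ∫ ω in tail (n (k + 1)), |f' ω - f ω| ∂P) atTop (𝓝 0) :=
      (htail0 _ hf'i).comp (hn_mono.tendsto_atTop.comp (tendsto_add_atTop_nat 1))
    refine abs_eq_zero.1 (le_antisymm (ge_of_tendsto' h1 fun k => ?_) (abs_nonneg _))
    simpa [hzero k] using happrox _ hf'i k
  have hlast := (hf'lim Einf).abs
  rw [hzero', abs_zero] at hlast
  have := ge_of_tendsto' hlast hbig
  linarith

end DunfordPettis

/-! ### Conditional increments along a chain -/

section Increments

variable {ι Ω : Type*} [LinearOrder ι] {mΩ : MeasurableSpace Ω} {P : Measure Ω}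
  {F : Filtration ι mΩ} {X : ι → Ω → ℝ}

/-- The version `max (E[X_υ | F_τ] - X_τ) 0` of the conditional increment over `p = (τ, υ)`, which
is nonnegative everywhere. -/
noncomputable def condIncrement (P : Measure Ω) (F : Filtration ι mΩ) (X : ι → Ω → ℝ) (p : ι × ι) :
    Ω → ℝ :=
  fun ω => max ((P[X p.2 | F p.1]) ω - X p.1 ω) 0

lemma condIncrement_nonneg (p : ι × ι) (ω : Ω) : 0 ≤ condIncrement P F X p ω := le_max_right _ _

lemma stronglyMeasurable_condIncrement (hX : Submartingale X F P) (p : ι × ι) :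
    StronglyMeasurable[F p.1] (condIncrement P F X p) :=
  ((stronglyMeasurable_condExp.sub (hX.1 p.1)).measurable.max measurable_const).stronglyMeasurable

lemma condIncrement_ae_eq (hX : Submartingale X F P) {p : ι × ι} (hp : p.1 ≤ p.2) :
    condIncrement P F X p =ᵐ[P] fun ω => (P[X p.2 | F p.1]) ω - X p.1 ω := by
  filter_upwards [hX.2.1 p.1 p.2 hp] with ω hω
  exact max_eq_left (sub_nonneg.2 hω)

lemma integrable_condIncrement (hX : Submartingale X F P) {p : ι × ι} (hp : p.1 ≤ p.2) :
    Integrable (condIncrement P F X p) P :=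
  (integrable_condExp.sub (hX.integrable p.1)).congr (condIncrement_ae_eq hX hp).symm

lemma setIntegral_condIncrement [IsProbabilityMeasure P] (hX : Submartingale X F P)
    {p : ι × ι} (hp : p.1 ≤ p.2) {B : Set Ω} (hB : MeasurableSet[F p.1] B) :
    ∫ ω in B, condIncrement P F X p ω ∂P = (∫ ω in B, X p.2 ω ∂P) - ∫ ω in B, X p.1 ω ∂P := by
  rw [setIntegral_congr_ae (F.le p.1 B hB)
      ((condIncrement_ae_eq hX hp).mono fun ω h _ => h),
    integral_sub integrable_condExp.integrableOn (hX.integrable p.1).integrableOn,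
    setIntegral_condExp (F.le p.1) (hX.integrable p.2) hB]

/-- The intervals recorded by the pairs of `d` do not overlap. -/
def NonOverlapping (d : Finset (ι × ι)) : Prop :=
  ∀ p ∈ d, ∀ q ∈ d, p ≠ q → p.2 ≤ q.1 ∨ q.2 ≤ p.1

/-- A finite set of times can be strung into a chain ending at the last time; on events known at
one of these times, the total of the conditional increments along the chain dominates in mean the
increment of the submartingale up to the last time. -/
lemma exists_chain_condIncrement [IsProbabilityMeasure P] (hX : Submartingale X F P) {e : ι}
    (he : ∀ i, i ≤ e) (t : Finset ι) :
    ∃ (b : ι) (d : Finset (ι × ι)), (b = e ∨ b ∈ t) ∧ (∀ τ ∈ t, b ≤ τ) ∧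
      (∀ p ∈ d, b ≤ p.1 ∧ p.1 ≤ p.2) ∧ NonOverlapping d ∧
      ∀ τ, (τ = b ∨ τ ∈ t) → ∀ B, MeasurableSet[F τ] B →
        (∫ ω in B, X e ω ∂P) - ∫ ω in B, X τ ω ∂P ≤
          ∑ p ∈ d, ∫ ω in B, condIncrement P F X p ω ∂P := by
  classical
  induction t using Finset.induction_on_min with
  | empty =>
    refine ⟨e, ∅, Or.inl rfl, by simp, by simp, by simp [NonOverlapping], ?_⟩
    rintro τ (rfl | h) B hB
    · simp
    · simp at h
  | insert a t hat ih =>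
    obtain ⟨b, d, hb, hbt, hd, hno, hint⟩ := ih
    have hab : a ≤ b := by
      rcases hb with rfl | hb
      · exact he a
      · exact (hat b hb).le
    rcases hab.eq_or_lt with rfl | hab
    · refine ⟨a, d, Or.inr (Finset.mem_insert_self _ _), ?_, hd, hno, ?_⟩
      · simpa using hbt
      · intro τ hτ B hB
        refine hint τ ?_ B hB
        simpa using hτ
    · have hnotin : (a, b) ∉ d := fun h => hab.not_ge (hd _ h).1
      refine ⟨a, insert (a, b) d, Or.inr (Finset.mem_insert_self _ _), ?_, ?_, ?_, ?_⟩
      · intro τ hτ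
        rcases Finset.mem_insert.1 hτ with rfl | hτ
        · exact le_rfl
        · exact (hat τ hτ).le
      · intro p hp
        rcases Finset.mem_insert.1 hp with rfl | hp
        · exact ⟨le_rfl, hab.le⟩
        · exact ⟨hab.le.trans (hd p hp).1, (hd p hp).2⟩
      · intro p hp q hq hpq
        rcases Finset.mem_insert.1 hp with rfl | hp <;> rcases Finset.mem_insert.1 hq with rfl | hq
        · exact absurd rfl hpq
        · exact Or.inl (hd q hq).1
        · exact Or.inr (hd p hp).1
        · exact hno p hp q hq hpq
      · intro τ hτ B hB
        rw [Finset.sum_insert hnotin]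
        have hτ' : τ = a ∨ τ ∈ t := by simpa using hτ
        rcases hτ' with rfl | hτ'
        · have h1 := setIntegral_condIncrement hX (p := (τ, b)) hab.le hB
          have h2 := hint b (Or.inl rfl) B (F.mono hab.le B hB)
          simp only at h1
          linarith
        · have h1 : 0 ≤ ∫ ω in B, condIncrement P F X (a, b) ω ∂P :=
            integral_nonneg fun ω => condIncrement_nonneg _ ω
          linarith [hint τ (Or.inr hτ') B hB]

/-- A monotone function grows over nonoverlapping intervals, all to the right of `a`, by at most
its total growth from `a` to the last point. -/
lemma sum_increment_le {e : ι} (he : ∀ i, i ≤ e) (g : ι → ℝ) (d : Finset (ι × ι))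
    (hd : ∀ p ∈ d, p.1 < p.2) (hno : NonOverlapping d) (a : ι) (ha : ∀ p ∈ d, a ≤ p.1)
    (hg : ∀ i j, a ≤ i → i ≤ j → g i ≤ g j) :
    ∑ p ∈ d, (g p.2 - g p.1) ≤ g e - g a := by
  classical
  induction d using Finset.induction_on_min_value (Prod.fst : ι × ι → ι) generalizing a with
  | empty => simpa using hg a e le_rfl (he a)
  | insert p s hps hmin ih =>
    have hap := ha p (Finset.mem_insert_self _ _)
    have hpp := hd p (Finset.mem_insert_self _ _)
    have hs : ∀ q ∈ s, p.2 ≤ q.1 := fun q hq => by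
      rcases hno p (Finset.mem_insert_self _ _) q (Finset.mem_insert_of_mem hq)
        (fun h => hps (h ▸ hq)) with h | h
      · exact h
      · exact absurd ((hd q (Finset.mem_insert_of_mem hq)).trans_le (h.trans (hmin q hq)))
          (lt_irrefl _)
    have h1 := ih (fun q hq => hd q (Finset.mem_insert_of_mem hq))
      (fun q hq r hr => hno q (Finset.mem_insert_of_mem hq) r (Finset.mem_insert_of_mem hr))
      p.2 hs (fun i j hi hij => hg i j (hap.trans (hpp.le.trans hi)) hij)
    rw [Finset.sum_insert hps]
    linarith [hg a p.1 le_rfl hap]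

/-- The sum of the conditional increments, crossing the level `c`. The event `Ev p` says that the
partial sums first exceed `c` with the increment over `p`; it is known at the time `p.1`, as each
increment is known at the left end of its interval. What accumulates beyond the level after that
time is at most the conditional increment of the submartingale up to the last time. -/
lemma exists_crossing_events [IsProbabilityMeasure P] (hX : Submartingale X F P) {e : ι}
    (he : ∀ i, i ≤ e)
    {d : Finset (ι × ι)} (hd : ∀ p ∈ d, p.1 < p.2) (hno : NonOverlapping d) {c : ℝ}
    (hc : 0 ≤ c) :
    ∃ Ev : ι × ι → Set Ω, (∀ p ∈ d, MeasurableSet[F p.1] (Ev p)) ∧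
      (d : Set (ι × ι)).PairwiseDisjoint Ev ∧
      (⋃ p ∈ d, Ev p) = {ω | c < ∑ q ∈ d, condIncrement P F X q ω} ∧
      ∀ p ∈ d, ∫ ω in Ev p, ((∑ q ∈ d, condIncrement P F X q ω) - c) ∂P ≤
        (∫ ω in Ev p, X e ω ∂P) - ∫ ω in Ev p, X p.1 ω ∂P := by
  classical
  set incr := condIncrement P F X with hincr
  have hincr0 : ∀ p ω, 0 ≤ incr p ω := condIncrement_nonneg
  set upTo : ι → Ω → ℝ := fun i ω => ∑ q ∈ d with q.1 ≤ i, incr q ω with hupTo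
  set before : ι → Ω → ℝ := fun i ω => ∑ q ∈ d with q.1 < i, incr q ω with hbefore
  have hmeas : ∀ (i : ι) (s : Finset (ι × ι)), (∀ q ∈ s, q.1 ≤ i) →
      StronglyMeasurable[F i] fun ω => ∑ q ∈ s, incr q ω := fun i s hs =>
    Finset.stronglyMeasurable_fun_sum s fun q hq =>
      (stronglyMeasurable_condIncrement hX q).mono (F.mono (hs q hq))
  have hupTo_le : ∀ i ω, upTo i ω ≤ ∑ q ∈ d, incr q ω := fun i ω =>
    Finset.sum_le_sum_of_subset_of_nonneg (Finset.filter_subset _ _) fun q _ _ => hincr0 q ω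
  have hupTo_before : ∀ {i j}, i < j → ∀ ω, upTo i ω ≤ before j ω := fun {i j} hij ω =>
    Finset.sum_le_sum_of_subset_of_nonneg
      (Finset.monotone_filter_right _ fun q _ hq => hq.trans_lt hij) fun q _ _ => hincr0 q ω
  set Ev : ι × ι → Set Ω := fun p => {ω | c < upTo p.1 ω} ∩ {ω | before p.1 ω ≤ c} with hEv
  have hEvm : ∀ p, MeasurableSet[F p.1] (Ev p) := fun p => by
    have h1 := hmeas p.1 {q ∈ d | q.1 ≤ p.1} (fun q hq => (Finset.mem_filter.1 hq).2)
    have h2 := hmeas p.1 {q ∈ d | q.1 < p.1} (fun q hq => (Finset.mem_filter.1 hq).2.le)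
    exact (@measurableSet_lt _ _ _ _ _ (F p.1) _ _ _ _ _ measurable_const h1.measurable).inter
      (@measurableSet_le _ _ _ _ _ (F p.1) _ _ _ _ _ h2.measurable measurable_const)
  refine ⟨Ev, fun p _ => hEvm p, ?_, ?_, ?_⟩
  · have hlt : ∀ p q, p.1 < q.1 → Disjoint (Ev p) (Ev q) := fun p q hpq =>
      Set.disjoint_left.2 fun ω hp hq =>
        absurd (hp.1.trans_le (hupTo_before hpq ω)) (not_lt.2 hq.2)
    intro p hp q hq hpq
    rcases hno p hp q hq hpq with h | h
    · exact hlt p q ((hd p hp).trans_le h)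
    · exact (hlt q p ((hd q hq).trans_le h)).symm
  · ext ω
    simp only [Set.mem_iUnion, Set.mem_ofPred_eq, exists_prop]
    constructor
    · rintro ⟨p, hp, h⟩
      exact h.1.trans_le (hupTo_le _ ω)
    · intro hω
      have hne : d.Nonempty := by
        by_contra hne
        rw [Finset.not_nonempty_iff_eq_empty.1 hne, Finset.sum_empty] at hω
        linarith
      obtain ⟨m, hm, hmmax⟩ := Finset.exists_max_image d Prod.fst hne
      have hmc : m ∈ d.filter fun p => c < upTo p.1 ω := by
        refine Finset.mem_filter.2 ⟨hm, ?_⟩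
        simp only [hupTo]
        rwa [Finset.filter_true_of_mem hmmax]
      obtain ⟨p, hp, hpmin⟩ := Finset.exists_min_image _ Prod.fst ⟨m, hmc⟩
      rw [Finset.mem_filter] at hp
      refine ⟨p, hp.1, hp.2, ?_⟩
      simp only [Set.mem_ofPred_eq, hbefore]
      rcases (d.filter fun q => q.1 < p.1).eq_empty_or_nonempty with h | h
      · rw [h, Finset.sum_empty]; exact hc
      · obtain ⟨q, hq, hqmax⟩ := Finset.exists_max_image _ Prod.fst h
        rw [Finset.mem_filter] at hq
        have heq : (d.filter fun r => r.1 < p.1) = d.filter fun r => r.1 ≤ q.1 :=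
          Finset.filter_congr fun r hr =>
            ⟨fun hrp => hqmax r (Finset.mem_filter.2 ⟨hr, hrp⟩), fun hrq => hrq.trans_lt hq.2⟩
        rw [heq]
        by_contra hlt
        exact absurd hq.2 (not_lt.2 (hpmin q (Finset.mem_filter.2 ⟨hq.1, not_le.1 hlt⟩)))
  · intro p hp
    have hint : ∀ q ∈ d, Integrable (incr q) P := fun q hq =>
      integrable_condIncrement hX (hd q hq).le
    have hstep : ∫ ω in Ev p, ((∑ q ∈ d, incr q ω) - c) ∂P ≤
        ∫ ω in Ev p, (∑ q ∈ d with ¬ q.1 < p.1, incr q ω) ∂P := by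
      refine setIntegral_mono_on
        ((integrable_finsetSum d hint).sub (integrable_const c)).integrableOn
        (integrable_finsetSum _ fun q hq => hint q (Finset.mem_filter.1 hq).1).integrableOn
        (F.le _ _ (hEvm p)) fun ω hω => ?_
      have hb : before p.1 ω ≤ c := hω.2
      rw [← Finset.sum_filter_add_sum_filter_not d fun q => q.1 < p.1]
      linarith
    refine hstep.trans ?_
    rw [integral_finsetSum _ fun q hq => (hint q (Finset.mem_filter.1 hq).1).integrableOn]
    have hge : ∀ q ∈ d.filter (fun q => ¬ q.1 < p.1), q ∈ d ∧ p.1 ≤ q.1 := fun q hq =>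
      ⟨(Finset.mem_filter.1 hq).1, not_lt.1 (Finset.mem_filter.1 hq).2⟩
    rw [Finset.sum_congr rfl fun q hq => setIntegral_condIncrement hX (hd q (hge q hq).1).le
      (F.mono (hge q hq).2 _ (hEvm p))]
    exact sum_increment_le he (fun i => ∫ ω in Ev p, X i ω ∂P) _
      (fun q hq => hd q (hge q hq).1)
      (fun q hq r hr => hno q (hge q hq).1 r (hge r hr).1) p.1 (fun q hq => (hge q hq).2)
      (fun i j hi hij => hX.setIntegral_le hij (F.mono hi _ (hEvm p)))

end Increments

/-! ### Integrals over superlevel sets -/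

section Truncation

variable {Ω : Type*} {mΩ : MeasurableSpace Ω} {P : Measure Ω}

lemma exists_pos_forall_setIntegral_abs_le [IsFiniteMeasure P] {f : Ω → ℝ} (hf : Integrable f P)
    {ε : ℝ} (hε : 0 < ε) : ∃ δ > 0, ∀ A, P.real A ≤ δ → ∫ ω in A, |f ω| ∂P ≤ ε := by
  have h : Tendsto (fun A : Set Ω => ∫ ω in A, |f ω| ∂P) (comap P (𝓝 0)) (𝓝 0) :=
    hf.abs.tendsto_setIntegral_nhds_zero tendsto_comap
  obtain ⟨V, hV, hVsub⟩ := mem_comap.1 (h (ge_mem_nhds hε))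
  obtain ⟨δ, hδ, hδV⟩ := ENNReal.nhds_zero_basis_Iic.mem_iff.1 hV
  have hmin : min δ 1 ≠ ∞ := ne_top_of_le_ne_top ENNReal.one_ne_top (min_le_right _ _)
  refine ⟨(min δ 1).toReal, ENNReal.toReal_pos (lt_min hδ one_pos).ne' hmin, fun A hA => hVsub ?_⟩
  exact hδV (((ENNReal.toReal_le_toReal (measure_ne_top P A) hmin).1 hA).trans (min_le_left _ _))

lemma setIntegral_abs_superlevel_congr {f g : Ω → ℝ} (hfg : f =ᵐ[P] g) (M : ℝ) :
    ∫ ω in {ω | M < |f ω|}, |f ω| ∂P = ∫ ω in {ω | M < |g ω|}, |g ω| ∂P := by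
  have h1 : {ω | M < |f ω|} =ᵐ[P] {ω | M < |g ω|} := by
    filter_upwards [hfg] with ω hω
    exact propext (by change M < |f ω| ↔ M < |g ω|; rw [hω])
  rw [setIntegral_congr_set h1]
  exact integral_congr_ae (ae_restrict_of_ae (hfg.mono fun ω h => by simp only [h]))

lemma mul_measure_superlevel_le [IsFiniteMeasure P] {g : Ω → ℝ} (hg : Integrable g P)
    (hgm : Measurable g) (c : ℝ) :
    c * P.real {ω | c < g ω} ≤ ∫ ω in {ω | c < g ω}, g ω ∂P := by
  have h := setIntegral_mono_on (μ := P) (f := fun _ => c) (integrable_const c).integrableOn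
    hg.integrableOn (measurableSet_lt measurable_const hgm) fun ω hω => le_of_lt hω
  rwa [setIntegral_const, smul_eq_mul, mul_comm] at h

lemma setIntegral_abs_superlevel {g : Ω → ℝ} (hg : Integrable g P) (hgm : Measurable g) {c : ℝ}
    (hc : 0 ≤ c) :
    ∫ ω in {ω | c < |g ω|}, |g ω| ∂P =
      (∫ ω in {ω | c < g ω}, g ω ∂P) + ∫ ω in {ω | c < -g ω}, -g ω ∂P := by
  have hm1 : MeasurableSet {ω | c < g ω} := measurableSet_lt measurable_const hgm
  have hm2 : MeasurableSet {ω | c < -g ω} := measurableSet_lt measurable_const hgm.neg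
  have hunion : {ω | c < |g ω|} = {ω | c < g ω} ∪ {ω | c < -g ω} := by
    ext ω; exact lt_abs (a := c) (b := g ω)
  rw [hunion, setIntegral_union (Set.disjoint_left.2 fun ω h1 h2 => ?_) hm2
    hg.abs.integrableOn hg.abs.integrableOn]
  · congr 1
    · exact setIntegral_congr_fun hm1 fun ω hω => abs_of_pos (hc.trans_lt hω)
    · exact setIntegral_congr_fun hm2 fun ω hω =>
        abs_of_neg (neg_pos.1 (hc.trans_lt hω))
  · have h1' : c < g ω := h1
    have h2' : c < -g ω := h2
    linarith

end Truncation

/-! ### Values at simple stopping times -/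

section SimpleStoppingTime

variable {T Ω : Type*} {mΩ : MeasurableSpace Ω} {𝒞 : Set (Set T)} {P : Measure Ω}
  {F : Filtration (Index 𝒞) mΩ} {X : Index 𝒞 → Ω → ℝ}

lemma Index.le_last (h : ∅ ∈ 𝒞) (τ : Index 𝒞) : τ ≤ Index.last h :=
  show (∅ : Set T) ⊆ _ from Set.empty_subset _

lemma Index.le_iff {τ υ : Index 𝒞} : τ ≤ υ ↔ υ.toSet ⊆ τ.toSet := Iff.rfl

/-- The linear order that an index set inherits when its members are pairwise comparable; it
extends the given order. -/
noncomputable abbrev Index.linearOrder (hlin : IsChain (· ⊆ ·) 𝒞) : LinearOrder (Index 𝒞) where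
  __ := (inferInstance : PartialOrder (Index 𝒞))
  le_total τ υ := (hlin.total (OrderDual.ofDual τ).2 (OrderDual.ofDual υ).2).symm
  toDecidableLE := Classical.decRel _

lemma setIntegral_valueAt (h : ∅ ∈ 𝒞) {Z : Index 𝒞 → Ω → ℝ} (hZ : ∀ τ, Integrable (Z τ) P)
    (σ : SimpleStoppingTime F) (B : Set Ω) :
    ∫ ω in B, valueAt h Z σ ω ∂P = (∑ n, ∫ ω in B ∩ σ.event n, Z (σ.time n) ω ∂P) +
      ∫ ω in B ∩ ⋂ n, (σ.event n)ᶜ, Z (Index.last h) ω ∂P := by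
  have hev : ∀ n, MeasurableSet (σ.event n) := fun n => F.le _ _ (σ.measurable_event n)
  have hrest : MeasurableSet (⋂ n, (σ.event n)ᶜ) := .iInter fun n => (hev n).compl
  have hi : ∀ n, Integrable ((σ.event n).indicator (Z (σ.time n))) P := fun n =>
    (hZ _).indicator (hev n)
  simp only [valueAt]
  rw [integral_add (integrable_finsetSum _ fun n _ => hi n).integrableOn
    ((hZ _).indicator hrest).integrableOn, integral_finsetSum _ fun n _ => (hi n).integrableOn,
    setIntegral_indicator hrest]
  congr 1
  exact Finset.sum_congr rfl fun n _ => setIntegral_indicator (hev n)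

lemma valueAt_of_mem (h : ∅ ∈ 𝒞) (Z : Index 𝒞 → Ω → ℝ) (σ : SimpleStoppingTime F) {n : Fin σ.N}
    {ω : Ω} (hω : ω ∈ σ.event n) : valueAt h Z σ ω = Z (σ.time n) ω := by
  have h1 : ω ∉ ⋂ n, (σ.event n)ᶜ := fun hc => Set.mem_iInter.1 hc n hω
  simp only [valueAt]
  rw [Set.indicator_of_notMem h1, add_zero, Finset.sum_eq_single n, Set.indicator_of_mem hω]
  · intro m _ hmn
    exact Set.indicator_of_notMem (fun hm => Set.disjoint_left.1 (σ.disjoint_event hmn) hm hω) _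
  · simp

lemma valueAt_of_forall_notMem (h : ∅ ∈ 𝒞) (Z : Index 𝒞 → Ω → ℝ) (σ : SimpleStoppingTime F) {ω : Ω}
    (hω : ∀ n, ω ∉ σ.event n) : valueAt h Z σ ω = Z (Index.last h) ω := by
  have h1 : ω ∈ ⋂ n, (σ.event n)ᶜ := Set.mem_iInter.2 hω
  simp only [valueAt]
  rw [Set.indicator_of_mem h1, Finset.sum_eq_zero, zero_add]
  exact fun n _ => Set.indicator_of_notMem (hω n) _

lemma valueAt_const (h : ∅ ∈ 𝒞) (f : Ω → ℝ) (σ : SimpleStoppingTime F) :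
    valueAt h (fun _ => f) σ = f := by
  funext ω
  by_cases hω : ∃ n, ω ∈ σ.event n
  · obtain ⟨n, hn⟩ := hω
    exact valueAt_of_mem h _ σ hn
  · exact valueAt_of_forall_notMem h _ σ (not_exists.1 hω)

lemma integrable_valueAt (h : ∅ ∈ 𝒞) (hX : Submartingale X F P) (σ : SimpleStoppingTime F) :
    Integrable (valueAt h X σ) P :=
  (integrable_finsetSum _ fun n _ => (hX.integrable _).indicator
    (F.le _ _ (σ.measurable_event n))).add ((hX.integrable _).indicator
      (.iInter fun n => (F.le _ _ (σ.measurable_event n)).compl))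

lemma measurable_valueAt (h : ∅ ∈ 𝒞) (hX : Submartingale X F P) (σ : SimpleStoppingTime F) :
    Measurable (valueAt h X σ) := by
  have hXm : ∀ τ, Measurable (X τ) := fun τ => ((hX.1 τ).mono (F.le τ)).measurable
  exact (Finset.measurable_fun_sum _ fun n _ => (hXm _).indicator
    (F.le _ _ (σ.measurable_event n))).add ((hXm _).indicator
      (.iInter fun n => (F.le _ _ (σ.measurable_event n)).compl))

/-- An inequality between integrals which holds on each event of a simple stopping time `σ`, and
outside them at the last index, passes to the values at `σ`. -/
lemma setIntegral_valueAt_le (h : ∅ ∈ 𝒞) {Z Z' : Index 𝒞 → Ω → ℝ}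
    (hZ : ∀ τ, Integrable (Z τ) P) (hZ' : ∀ τ, Integrable (Z' τ) P) (σ : SimpleStoppingTime F)
    {B : Set Ω}
    (hle : ∀ n, ∫ ω in B ∩ σ.event n, Z (σ.time n) ω ∂P ≤
      ∫ ω in B ∩ σ.event n, Z' (σ.time n) ω ∂P)
    (hlast : ∫ ω in B ∩ ⋂ n, (σ.event n)ᶜ, Z (Index.last h) ω ∂P ≤
      ∫ ω in B ∩ ⋂ n, (σ.event n)ᶜ, Z' (Index.last h) ω ∂P) :
    ∫ ω in B, valueAt h Z σ ω ∂P ≤ ∫ ω in B, valueAt h Z' σ ω ∂P := by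
  rw [setIntegral_valueAt h hZ, setIntegral_valueAt h hZ']
  exact add_le_add (Finset.sum_le_sum fun n _ => hle n) hlast

lemma measurableSet_preimage_valueAt_inter_event (h : ∅ ∈ 𝒞) (hX : Submartingale X F P)
    (σ : SimpleStoppingTime F) {V : Set ℝ} (hV : MeasurableSet V) (n : Fin σ.N) :
    MeasurableSet[F (σ.time n)] (valueAt h X σ ⁻¹' V ∩ σ.event n) := by
  have : valueAt h X σ ⁻¹' V ∩ σ.event n = X (σ.time n) ⁻¹' V ∩ σ.event n := by
    ext ω
    refine and_congr_left fun hω => ?_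
    rw [Set.mem_preimage, Set.mem_preimage, valueAt_of_mem h X σ hω]
  rw [this]
  exact ((hX.1 _).measurable hV).inter (σ.measurable_event n)

end SimpleStoppingTime

/-! ### The equivalence of the two classes -/

section Equivalence

variable {T Ω : Type*} {mΩ : MeasurableSpace Ω} {𝒞 : Set (Set T)} {P : Measure Ω}
  {F : Filtration (Index 𝒞) mΩ} {X : Index 𝒞 → Ω → ℝ}

lemma isDisjointCollection_of_order {d : Finset (Index 𝒞 × Index 𝒞)}
    (hd : ∀ p ∈ d, p.1 ≤ p.2) (hno : ∀ p ∈ d, ∀ q ∈ d, p ≠ q → p.2 ≤ q.1 ∨ q.2 ≤ p.1) :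
    IsDisjointCollection d := by
  refine ⟨hd, fun p hp q hq hpq => Set.disjoint_left.2 fun x hxp hxq => ?_⟩
  rcases hno p hp q hq hpq with h | h
  · exact hxp.2 (h hxq.1)
  · exact hxq.2 (h hxp.1)

/-- Along a chain, disjoint nonempty intervals follow one another. -/
lemma IsDisjointCollection.le_or_le (hlin : IsChain (· ⊆ ·) 𝒞)
    {d : Finset (Index 𝒞 × Index 𝒞)} (hd : IsDisjointCollection d) {p q : Index 𝒞 × Index 𝒞}
    (hp : p ∈ d) (hq : q ∈ d) (hpq : p ≠ q) (hp' : p.1 < p.2) (hq' : q.1 < q.2) :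
    p.2 ≤ q.1 ∨ q.2 ≤ p.1 := by
  let := Index.linearOrder hlin
  by_contra! hcon
  -- The overlap of the two intervals runs from `max p.1 q.1` to `min p.2 q.2`.
  have hlt : max p.1 q.1 < min p.2 q.2 :=
    max_lt (lt_min hp' hcon.2) (lt_min hcon.1 hq')
  obtain ⟨x, hx, hx'⟩ := Set.not_subset.1 (fun h => hlt.not_ge (Index.le_iff.2 h))
  have hx1 : x ∈ p.1.toSet ∩ q.1.toSet :=
    ⟨Index.le_iff.1 (le_max_left p.1 q.1) hx, Index.le_iff.1 (le_max_right p.1 q.1) hx⟩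
  exact Set.disjoint_left.1 (hd.2 hp hq hpq)
    ⟨hx1.1, fun h => hx' (Index.le_iff.1 (min_le_left p.2 q.2) h)⟩
    ⟨hx1.2, fun h => hx' (Index.le_iff.1 (min_le_right p.2 q.2) h)⟩

/-- The level `(K + 1) / δ` in Markov's inequality: a quantity with mean at most `K` exceeds it
with probability at most `δ`. -/
lemma le_of_mul_le_of_div {x K δ : ℝ} (hK : 0 ≤ K) (hδ : 0 < δ) (h : (K + 1) / δ * x ≤ K) :
    x ≤ δ := by
  rw [div_mul_eq_mul_div, div_le_iff₀ hδ] at h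
  by_contra! hlt
  nlinarith

/-- For a stopping time `σ`, the chain through its times gives a sum `A` of conditional increments
with `E[X_∅ - A | F_σ] ≤ X_σ ≤ E[X_∅ | F_σ]`. The uniform absolute continuity of the sums then
passes to the values `X_σ`. -/
theorem ClassDM.classD [IsProbabilityMeasure P] (hempty : ∅ ∈ 𝒞) (hlin : IsChain (· ⊆ ·) 𝒞)
    (hX : Submartingale X F P) (hDM : ClassDM P F X) : ClassD P F hempty X := by
  classical
  let := Index.linearOrder hlin
  set e : Index 𝒞 := Index.last hempty with he
  have hXe : Integrable (X e) P := hX.integrable e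
  obtain ⟨C, hC⟩ := IsRelativelyWeaklyCompact.exists_bound hDM (setIntegralDual P Set.univ)
  refine isRelativelyWeaklyCompact_of_truncation fun ε hε => ?_
  obtain ⟨δ₁, hδ₁, hUAC⟩ :=
    IsRelativelyWeaklyCompact.uniformlyAbsolutelyContinuous hDM (ε / 4) (by positivity)
  obtain ⟨δ₂, hδ₂, hAC⟩ := exists_pos_forall_setIntegral_abs_le hXe (ε := ε / 4) (by positivity)
  set K : ℝ := (∫ ω, |X e ω| ∂P) + |C| with hK
  have hK0 : 0 ≤ K := add_nonneg (integral_nonneg fun _ => abs_nonneg _) (abs_nonneg _)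
  have hδ : 0 < min δ₁ δ₂ := lt_min hδ₁ hδ₂
  set c : ℝ := (K + 1) / min δ₁ δ₂ with hc
  have hc0 : 0 ≤ c := by positivity
  refine ⟨c, ?_⟩
  rintro f ⟨σ, hf⟩
  rw [setIntegral_abs_superlevel_congr hf]
  set v := valueAt hempty X σ with hv
  have hvi : Integrable v P := integrable_valueAt hempty hX σ
  have hvm : Measurable v := measurable_valueAt hempty hX σ
  obtain ⟨b, d, -, -, hd, hno, hchain⟩ := exists_chain_condIncrement hX
    (Index.le_last hempty) (Finset.univ.image σ.time)
  set A : Ω → ℝ := fun ω => ∑ p ∈ d, condIncrement P F X p ω with hA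
  have hinc : ∀ p ∈ d, Integrable (condIncrement P F X p) P := fun p hp =>
    integrable_condIncrement hX (hd p hp).2
  have hAi : Integrable A P := integrable_finsetSum _ hinc
  have hA0 : ∀ ω, 0 ≤ A ω := fun ω => Finset.sum_nonneg fun p _ => condIncrement_nonneg p ω
  set fA : Lp ℝ 1 P := hAi.toL1 A with hfA
  have hfA_eq : fA =ᵐ[P] A := hAi.coeFn_toL1
  have hfA_mem : fA ∈ conditionalSums P F X := by
    refine ⟨d, isDisjointCollection_of_order (fun p hp => (hd p hp).2) hno, hfA_eq.trans ?_⟩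
    have := (Finset.eventually_all d).2 fun p hp => condIncrement_ae_eq hX (hd p hp).2
    filter_upwards [this] with ω hω
    exact Finset.sum_congr rfl hω
  have hAint : ∫ ω, A ω ∂P ≤ |C| := by
    have h := hC fA hfA_mem
    rw [setIntegralDual_apply, setIntegral_univ, integral_congr_ae hfA_eq] at h
    exact (le_abs_self _).trans (h.trans (le_abs_self _))
  have hAsmall : ∀ B, MeasurableSet B → P.real B ≤ δ₁ → ∫ ω in B, A ω ∂P ≤ ε / 4 := by
    intro B hB hPB
    refine le_of_eq_of_le (integral_congr_ae (ae_restrict_of_ae ?_)) (hUAC fA hfA_mem B hB hPB)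
    filter_upwards [hfA_eq] with ω hω
    rw [hω, abs_of_nonneg (hA0 ω)]
  have hXe_le : ∀ B, |∫ ω in B, X e ω ∂P| ≤ ∫ ω in B, |X e ω| ∂P := fun B =>
    abs_integral_le_integral_abs
  have hmono : ∀ {h : Ω → ℝ}, Integrable h P → (∀ ω, 0 ≤ h ω) → ∀ B,
      ∫ ω in B, h ω ∂P ≤ ∫ ω, h ω ∂P := fun hi h0 B =>
    setIntegral_le_integral hi (.of_forall h0)
  have htime : ∀ n, σ.time n ∈ Finset.univ.image σ.time := fun n =>
    Finset.mem_image_of_mem _ (Finset.mem_univ n)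
  have hupper : ∀ V, MeasurableSet V → ∫ ω in v ⁻¹' V, v ω ∂P ≤ ∫ ω in v ⁻¹' V, X e ω ∂P := by
    intro V hV
    have h := setIntegral_valueAt_le (Z := X) (Z' := fun _ => X e) hempty hX.integrable
      (fun _ => hXe) σ (B := v ⁻¹' V) (fun n => hX.setIntegral_le (Index.le_last hempty _)
        (measurableSet_preimage_valueAt_inter_event hempty hX σ hV n)) le_rfl
    rwa [valueAt_const] at h
  have hlower : ∀ V, MeasurableSet V → ∫ ω in v ⁻¹' V, (X e ω - A ω) ∂P ≤
      ∫ ω in v ⁻¹' V, v ω ∂P := by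
    intro V hV
    have h := setIntegral_valueAt_le (Z := fun _ ω => X e ω - A ω) (Z' := X) hempty
      (fun _ => hXe.sub hAi) hX.integrable σ (B := v ⁻¹' V) (fun n => ?_) ?_
    · rwa [valueAt_const] at h
    · rw [integral_sub hXe.integrableOn hAi.integrableOn,
        integral_finsetSum _ fun p hp => (hinc p hp).integrableOn]
      linarith [hchain _ (Or.inr (htime n)) _
        (measurableSet_preimage_valueAt_inter_event hempty hX σ hV n)]
    · exact integral_mono (hXe.sub hAi).integrableOn hXe.integrableOn fun ω =>
        sub_le_self _ (hA0 ω)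
  rw [setIntegral_abs_superlevel hvi hvm hc0]
  have hB2m : MeasurableSet {ω | c < -v ω} := measurableSet_lt measurable_const hvm.neg
  have h1 : ∫ ω in {ω | c < v ω}, v ω ∂P ≤ ∫ ω in {ω | c < v ω}, |X e ω| ∂P :=
    (hupper (Set.Ioi c) measurableSet_Ioi).trans ((le_abs_self _).trans (hXe_le _))
  have h2 : ∫ ω in {ω | c < -v ω}, -v ω ∂P ≤
      (∫ ω in {ω | c < -v ω}, |X e ω| ∂P) + ∫ ω in {ω | c < -v ω}, A ω ∂P := by
    have h := hlower {x | c < -x} (measurableSet_lt measurable_const measurable_neg)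
    rw [integral_sub hXe.integrableOn hAi.integrableOn] at h
    have h' := (neg_le_abs _).trans (hXe_le {ω | c < -v ω})
    rw [integral_neg]
    change (∫ ω in {ω | c < -v ω}, X e ω ∂P) - (∫ ω in {ω | c < -v ω}, A ω ∂P) ≤
      ∫ ω in {ω | c < -v ω}, v ω ∂P at h
    linarith
  have hP1 : P.real {ω | c < v ω} ≤ min δ₁ δ₂ := by
    refine le_of_mul_le_of_div hK0 hδ ((mul_measure_superlevel_le hvi hvm c).trans ?_)
    linarith [hmono hXe.abs (fun _ => abs_nonneg _) {ω | c < v ω}, abs_nonneg C]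
  have hP2 : P.real {ω | c < -v ω} ≤ min δ₁ δ₂ := by
    refine le_of_mul_le_of_div hK0 hδ ((mul_measure_superlevel_le hvi.neg hvm.neg c).trans ?_)
    refine h2.trans ?_
    linarith [hmono hXe.abs (fun _ => abs_nonneg _) {ω | c < -v ω}, hmono hAi hA0 {ω | c < -v ω}]
  linarith [hAC _ (hP1.trans (min_le_right _ _)), hAC _ (hP2.trans (min_le_right _ _)),
    hAsmall _ hB2m (hP2.trans (min_le_left _ _))]

/-- For a disjoint collection with sum `A` of conditional increments, let `σ` be the time at which
the partial sums are about to exceed `c`. Then `∫_{A > c} (A - c) ≤ ∫_{A > c} (X_∅ - X_σ)`, and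
`P(A > c)` is uniformly small for large `c` since the mean of `A` is bounded. -/
theorem ClassD.classDM [IsProbabilityMeasure P] (hempty : ∅ ∈ 𝒞) (hlin : IsChain (· ⊆ ·) 𝒞)
    (hX : Submartingale X F P) (hD : ClassD P F hempty X) : ClassDM P F X := by
  classical
  let := Index.linearOrder hlin
  set e : Index 𝒞 := Index.last hempty with he
  have hXe : Integrable (X e) P := hX.integrable e
  have htoL1 : ∀ σ : SimpleStoppingTime F, (integrable_valueAt hempty hX σ).toL1 _ ∈
      stoppedValues P F hempty X := fun σ =>
    ⟨σ, (integrable_valueAt hempty hX σ).coeFn_toL1⟩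
  obtain ⟨C, hC⟩ : ∃ C, ∀ τ, |∫ ω, X τ ω ∂P| ≤ C := by
    obtain ⟨C, hC⟩ := IsRelativelyWeaklyCompact.exists_bound hD (setIntegralDual P Set.univ)
    refine ⟨C, fun τ => ?_⟩
    -- `X_τ` is the value at the stopping time that is constantly `τ`.
    let σ : SimpleStoppingTime F :=
      { N := 1
        time := fun _ => τ
        event := fun _ => Set.univ
        measurable_event := fun _ => MeasurableSet.univ
        disjoint_event := fun m n h => absurd (Subsingleton.elim m n) h }
    have h := hC _ (htoL1 σ)
    rw [setIntegralDual_apply, setIntegral_univ,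
      integral_congr_ae (integrable_valueAt hempty hX σ).coeFn_toL1] at h
    convert h using 4 with ω
    exact (valueAt_of_mem hempty X σ (n := 0) (Set.mem_univ ω)).symm
  refine isRelativelyWeaklyCompact_of_truncation fun ε hε => ?_
  obtain ⟨δ₁, hδ₁, hUAC⟩ :=
    IsRelativelyWeaklyCompact.uniformlyAbsolutelyContinuous hD (ε / 4) (by positivity)
  obtain ⟨δ₂, hδ₂, hAC⟩ := exists_pos_forall_setIntegral_abs_le hXe (ε := ε / 4) (by positivity)
  have hδ : 0 < min δ₁ δ₂ := lt_min hδ₁ hδ₂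
  have hC0 : 0 ≤ C := (abs_nonneg _).trans (hC e)
  set c : ℝ := (2 * C + 1) / min δ₁ δ₂ with hc
  have hc0 : 0 ≤ c := by positivity
  refine ⟨2 * c, ?_⟩
  rintro f ⟨d', hd', hf⟩
  -- Pairs `(τ, τ)` record the empty set, put no constraint on the others, and contribute zero.
  set d := d'.filter fun p => p.1 < p.2 with hd_def
  have hd : ∀ p ∈ d, p.1 < p.2 := fun p hp => (Finset.mem_filter.1 hp).2
  have hno : NonOverlapping d := fun p hp q hq hpq =>
    hd'.le_or_le hlin (Finset.mem_filter.1 hp).1 (Finset.mem_filter.1 hq).1 hpq (hd p hp) (hd q hq)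
  set A : Ω → ℝ := fun ω => ∑ p ∈ d, condIncrement P F X p ω with hA
  have hinc : ∀ p ∈ d, Integrable (condIncrement P F X p) P := fun p hp =>
    integrable_condIncrement hX (hd p hp).le
  have hAi : Integrable A P := integrable_finsetSum _ hinc
  have hAm : Measurable A := Finset.measurable_fun_sum _ fun p _ =>
    ((stronglyMeasurable_condIncrement hX p).mono (F.le _)).measurable
  have hA0 : ∀ ω, 0 ≤ A ω := fun ω => Finset.sum_nonneg fun p _ => condIncrement_nonneg p ω
  have hfA : f =ᵐ[P] A := by
    refine hf.trans ?_
    have h1 := (Finset.eventually_all d').2 fun p hp => condIncrement_ae_eq hX (hd'.1 p hp)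
    have h2 : ∀ᵐ ω ∂P, ∀ p ∈ d', ¬ p.1 < p.2 → (P[X p.2 | F p.1]) ω - X p.1 ω = 0 := by
      refine (Finset.eventually_all d').2 fun p hp => .of_forall fun ω hlt => ?_
      have hpp : p.2 = p.1 := ((hd'.1 p hp).eq_or_lt.resolve_right hlt).symm
      rw [hpp, condExp_of_stronglyMeasurable (F.le _) (hX.1 _) (hX.integrable _), sub_self]
    filter_upwards [h1, h2] with ω h1 h2
    simp only [conditionalSum, hA, hd_def]
    rw [Finset.sum_filter]
    refine Finset.sum_congr rfl fun p hp => ?_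
    split_ifs with hlt
    · exact (h1 p hp).symm
    · exact h2 p hp hlt
  rw [setIntegral_abs_superlevel_congr hfA]
  simp only [abs_of_nonneg (hA0 _)]
  have hAint : ∫ ω, A ω ∂P ≤ 2 * C := by
    rcases d.eq_empty_or_nonempty with h | h
    · simp [hA, h, hC0]
    · obtain ⟨p, hp, hpmin⟩ := Finset.exists_min_image d Prod.fst h
      have h1 := sum_increment_le (Index.le_last hempty) (fun i => ∫ ω, X i ω ∂P) d hd hno p.1 hpmin
        (fun i j _ hij => by simpa using hX.setIntegral_le hij MeasurableSet.univ)
      rw [integral_finsetSum _ hinc, Finset.sum_congr rfl fun q hq => by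
        simpa using setIntegral_condIncrement hX (hd q hq).le MeasurableSet.univ]
      linarith [abs_le.1 (hC e), abs_le.1 (hC p.1)]
  obtain ⟨Ev, hEvm, hEvd, hEvU, hEv⟩ :=
    exists_crossing_events hX (Index.le_last hempty) hd hno hc0
  set B : Set Ω := {ω | c < A ω} with hB
  have hBm : MeasurableSet B := measurableSet_lt measurable_const hAm
  let σ : SimpleStoppingTime F :=
    { N := d.card
      time := fun n => (d.equivFin.symm n : Index 𝒞 × Index 𝒞).1
      event := fun n => Ev (d.equivFin.symm n)
      measurable_event := fun n => hEvm _ (d.equivFin.symm n).2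
      disjoint_event := fun m n hmn => hEvd (d.equivFin.symm m).2 (d.equivFin.symm n).2
        fun h => hmn (d.equivFin.symm.injective (Subtype.ext h)) }
  set v := valueAt hempty X σ with hv
  have hvi : Integrable v P := integrable_valueAt hempty hX σ
  have hmain : ∫ ω in B, v ω ∂P ≤ ∫ ω in B, (X e ω - (A ω - c)) ∂P := by
    have hAci : Integrable (fun ω => A ω - c) P := hAi.sub (integrable_const c)
    have h := setIntegral_valueAt_le (Z := X) (Z' := fun _ ω => X e ω - (A ω - c)) hempty
      hX.integrable (fun _ => hXe.sub hAci) σ (B := B) (fun n => ?_) ?_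
    · rwa [valueAt_const] at h
    · have hsub : σ.event n ⊆ B := by
        rw [← hEvU]
        exact Set.subset_biUnion_of_mem (u := Ev) (d.equivFin.symm n).2
      rw [Set.inter_eq_right.2 hsub, integral_sub hXe.integrableOn hAci.integrableOn]
      have := hEv _ (d.equivFin.symm n).2
      change ∫ ω in σ.event n, (A ω - c) ∂P ≤
        (∫ ω in σ.event n, X e ω ∂P) - ∫ ω in σ.event n, X (σ.time n) ω ∂P at this
      linarith
    · -- The events of `σ` exhaust `B`.
      have hempt : B ∩ ⋂ n, (σ.event n)ᶜ = ∅ := by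
        rw [← hEvU, Set.eq_empty_iff_forall_notMem]
        rintro ω ⟨hω, hω'⟩
        obtain ⟨p, hp, hωp⟩ := Set.mem_iUnion₂.1 hω
        refine Set.mem_iInter.1 hω' (d.equivFin ⟨p, hp⟩) ?_
        change ω ∈ Ev (d.equivFin.symm (d.equivFin ⟨p, hp⟩))
        rwa [Equiv.symm_apply_apply]
      rw [hempt, setIntegral_empty, setIntegral_empty]
  have hPB : P.real B ≤ min δ₁ δ₂ := by
    refine le_of_mul_le_of_div (by positivity) hδ ((mul_measure_superlevel_le hAi hAm c).trans ?_)
    exact (setIntegral_le_integral hAi (.of_forall hA0)).trans hAint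
  have hvsmall : ∫ ω in B, |v ω| ∂P ≤ ε / 4 := by
    refine le_of_eq_of_le (integral_congr_ae (ae_restrict_of_ae ?_))
      (hUAC _ (htoL1 σ) B hBm (hPB.trans (min_le_left _ _)))
    filter_upwards [hvi.coeFn_toL1] with ω hω
    rw [hω]
  have hexc : ∫ ω in B, (A ω - c) ∂P ≤ ε / 2 := by
    have hAci : Integrable (fun ω => A ω - c) P := hAi.sub (integrable_const c)
    rw [integral_sub hXe.integrableOn hAci.integrableOn] at hmain
    have h1 : ∫ ω in B, X e ω ∂P ≤ ∫ ω in B, |X e ω| ∂P :=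
      (le_abs_self _).trans abs_integral_le_integral_abs
    have h2 : -∫ ω in B, v ω ∂P ≤ ∫ ω in B, |v ω| ∂P :=
      (neg_le_abs _).trans abs_integral_le_integral_abs
    linarith [hAC _ (hPB.trans (min_le_right _ _))]
  have hAci : Integrable (fun ω => 2 * (A ω - c)) P := (hAi.sub (integrable_const c)).const_mul 2
  have hsub : {ω | 2 * c < A ω} ⊆ B := fun ω hω => by
    have : 2 * c < A ω := hω
    change c < A ω
    linarith
  -- Above the level `2 * c`, the sum `A` is at most twice its excess over `c`.
  calc ∫ ω in {ω | 2 * c < A ω}, A ω ∂P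
      ≤ ∫ ω in {ω | 2 * c < A ω}, 2 * (A ω - c) ∂P :=
        setIntegral_mono_on hAi.integrableOn hAci.integrableOn
          (measurableSet_lt measurable_const hAm) fun ω hω => by
            have : 2 * c < A ω := hω
            linarith
    _ ≤ ∫ ω in B, 2 * (A ω - c) ∂P := by
        refine setIntegral_mono_set hAci.integrableOn ?_ hsub.eventuallyLE
        filter_upwards [ae_restrict_mem hBm] with ω hω
        have : c < A ω := hω
        change 0 ≤ 2 * (A ω - c)
        linarith
    _ ≤ ε := by
        rw [integral_const_mul]
        linarith

end Equivalence

end SemilatticeProcess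

theorem mainTheorem11 {T Ω : Type*} [Preorder T]
    (hinf : ∀ s t : T, ∃ m : T, IsGLB {s, t} m)
    (htop : ∃ t : T, IsTop t)
    (hord : ∀ s t : T, Set.Ioi s ⊆ Set.Ioi t → t ≤ s)
    {mΩ : MeasurableSpace Ω} (P : MeasureTheory.Measure Ω) [MeasureTheory.IsProbabilityMeasure P]
    (𝒞 : Set (Set T)) (hring : 𝒞 ⊆ SemilatticeProcess.predictableRing T)
    (hempty : ∅ ∈ 𝒞) (hlin : IsChain (· ⊆ ·) 𝒞)
    (F : MeasureTheory.Filtration (SemilatticeProcess.Index 𝒞) mΩ)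
    (hF : F (SemilatticeProcess.Index.last hempty) = mΩ)
    (X : SemilatticeProcess.Index 𝒞 → Ω → ℝ) (hX : MeasureTheory.Submartingale X F P) :
    SemilatticeProcess.ClassDM P F X ↔ SemilatticeProcess.ClassD P F hempty X :=
  ⟨fun h => h.classD hempty hlin hX, fun h => h.classDM hempty hlin hX⟩
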